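/- Let $S$ be a finite or countably infinite set and let $P,R$ be Markov transition matrices on $S$. All products of (possibly infinite) matrices and row vectors are taken entrywise as series; we say that $x^\top A$ converges absolutely if $\sum_{i,j}|x_i||A_{ij}|<\infty$, and we write $x^\top A^k=(\cdots((x^\top A)A)\cdots)A$. Convergence of row vectors is in total variation, i.e. in the norm $\sum_{j}|x_j|$. Let $P$ be irreducible, aperiodic and positive recurrent with stationary distribution $\pi_P$, and let $\Pi_P$ be the matrix all of whose rows equal $\pi_P^\top$. Suppose that the deviation matrix $D_P=\sum_{k=0}^\infty (P^k-\Pi_P)$ exists, each row of the series converging in total variation. Put $A=(R-P)D_P$, and suppose that each row of this product and all the products $\pi_P^\top A^{k}$, $k\ge 0$, converge absolutely (all this is automatic if $S$ is finite). Suppose further that the series $$\mu^\top=\pi_P^\top\sum_{k=0}^\infty\big((R-P)D_P\big)^k=\sum_{k=0}^\infty\pi_P^\top A^k$$ converges in total variation. For $i\in S$ let ${}_iR$ denote $R$ with its $i$-th column replaced by zero. For $v:S\to[1,\infty)$ let $\|B\|_v=\sup_i v(i)^{-1}\sum_j|B_{ij}|v(j)$ (for $v\equiv1$ this is the $\infty$-norm),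 and let $\|B\|_1=\sup_j\sum_i|B_{ij}|$. (i) If $\mu_i\ge 0$ for all $i\in S$, then $\mu$ is a stationary distribution of $R$. (ii) If $R$ is irreducible and aperiodic and there is $i\in S$ such that $\|{}_iR\|_v<1$ for some $v:S\to[1,\infty)$ or $\|{}_iR\|_1<1$, then (without assuming $\mu\ge0$) $\mu$ is the unique stationary distribution $\pi_R$ of $R$. Moreover the bias term $$B(R,P)=\lim_{N\to\infty}\pi_R^\top\big((R-P)D_P\big)^N$$ exists (all the products converging absolutely and the limit being in total variation) and is the zero vector, provided that its first product $\pi_R^\top A$ converges absolutely, or that there are $v:S\to[1,\infty)$ and $i\in S$ with $\|{}_iR\|_v<1$ and $\|(R-P)D_P\|_v<\infty$; this proviso always holds if $S$ is finite. -/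

import Mathlib

open Filter Topology
open scoped ENNReal

namespace MarkovPerturbation

variable {S : Type*}

/-- Product `A B` of (possibly infinite) matrices. -/
noncomputable def mulMat (A B : Matrix S S ℝ) : Matrix S S ℝ :=
  fun i j => ∑' l, A i l * B l j

/-- Product `xᵀ A` of a row vector and a (possibly infinite) matrix. -/
noncomputable def rowMul (x : S → ℝ) (A : Matrix S S ℝ) : S → ℝ :=
  fun j => ∑' i, x i * A i j

/-- The product `xᵀ A` converges absolutely (over reals, `Summable` is absolute summability):
the double series `∑ i j, |x i| * |A i j|` is finite. -/
def AbsConv (x : S → ℝ) (A : Matrix S S ℝ) : Prop :=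
  Summable fun p : S × S => x p.1 * A p.1 p.2

/-- The row vector `xᵀ Aᵏ`, computed from the left: `(⋯((xᵀ A) A)⋯) A`. -/
noncomputable def rowPow (x : S → ℝ) (A : Matrix S S ℝ) : ℕ → S → ℝ
  | 0 => x
  | k + 1 => rowMul (rowPow x A k) A

open scoped Classical in
/-- The matrix power `Pᵏ`. -/
noncomputable def matPow (P : Matrix S S ℝ) : ℕ → Matrix S S ℝ
  | 0 => fun i j => if i = j then 1 else 0
  | k + 1 => mulMat (matPow P k) P

/-- Convergence of row vectors (signed measures on `S`) in total variation,
i.e. in the norm `∑ j, |x j|`. -/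
def TendstoTV (x : ℕ → S → ℝ) (y : S → ℝ) : Prop :=
  Tendsto (fun n => ∑' j, ENNReal.ofReal |x n j - y j|) atTop (𝓝 0)

/-- `P` is a Markov transition matrix on `S`. -/
structure IsStochastic (P : Matrix S S ℝ) : Prop where
  nonneg : ∀ i j, 0 ≤ P i j
  row_sum : ∀ i, HasSum (P i) 1

/-- `ρ` is a stationary distribution of `P`. -/
structure IsStationary (P : Matrix S S ℝ) (ρ : S → ℝ) : Prop where
  nonneg : ∀ i, 0 ≤ ρ i
  sum_one : HasSum ρ 1
  invariant : ∀ j, HasSum (fun i => ρ i * P i j) (ρ j)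

/-- Every state has period one: the only common divisor of the lengths of the loops at `i`
that have positive probability is `1`. -/
def IsAperiodic (P : Matrix S S ℝ) : Prop :=
  ∀ (i : S) (d : ℕ), (∀ n, 0 < matPow P n i i → d ∣ n) → d = 1

open scoped Classical in
/-- The taboo kernel `ᵢP`: the matrix `P` with its `i`-th column set to zero. -/
noncomputable def taboo (P : Matrix S S ℝ) (i : S) : Matrix S S ℝ :=
  fun k l => if l = i then 0 else P k l

/-- `firstPassage P j n i` is the probability that the chain started at `i` visits `j`
for the first time after time `0` at time `n`. -/
noncomputable def firstPassage (P : Matrix S S ℝ) (j : S) : ℕ → S → ℝ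
  | 0, _ => 0
  | 1, i => P i j
  | n + 2, i => ∑' l, taboo P j i l * firstPassage P j (n + 1) l

/-- Every state is recurrent with finite mean return time. -/
def IsPositiveRecurrent (P : Matrix S S ℝ) : Prop :=
  ∀ i, HasSum (fun n => firstPassage P i n i) 1 ∧
    Summable fun n : ℕ => (n : ℝ) * firstPassage P i n i

/-- `D` is the deviation matrix `∑ k, (Pᵏ - Π)` of `P`, where all rows of `Π` equal `π`;
the series converges in total variation in every row. -/
def IsDeviationMatrix (P : Matrix S S ℝ) (π : S → ℝ) (D : Matrix S S ℝ) : Prop :=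
  ∀ i, TendstoTV (fun n j => ∑ k ∈ Finset.range n, (matPow P k i j - π j)) (D i)

/-- A weight function for the `v`-norm. -/
def IsWeight (v : S → ℝ) : Prop := ∀ i, 1 ≤ v i

/-- The matrix norm induced by the weighted supremum norm `‖x‖ᵥ = sup i, |x i| / v i` on column
vectors; `v = 1` gives the `∞`-norm. -/
noncomputable def vNorm (v : S → ℝ) (A : Matrix S S ℝ) : ℝ≥0∞ :=
  ⨆ i, (∑' j, ENNReal.ofReal (|A i j| * v j)) / ENNReal.ofReal (v i)

/-- The matrix norm induced by `‖x‖₁ = ∑ i, |x i|` on column vectors. -/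
noncomputable def oneNorm (A : Matrix S S ℝ) : ℝ≥0∞ :=
  ⨆ j, ∑' i, ENNReal.ofReal |A i j|

/-- Some taboo kernel of `R` has norm less than one, in some `v`-norm or in the `1`-norm. -/
def HasProperTaboo (R : Matrix S S ℝ) : Prop :=
  ∃ i, (∃ v, IsWeight v ∧ vNorm v (taboo R i) < 1) ∨ oneNorm (taboo R i) < 1

/-- The row vector `b` is the limit, in total variation, of `xᵀ Aᴺ` as `N → ∞`, all the products
being absolutely convergent. With `x` the stationary distribution of `R` and `A = (R - P) D_P` it
is the bias term `B(R, P)`. -/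
def HasBiasTerm (x : S → ℝ) (A : Matrix S S ℝ) (b : S → ℝ) : Prop :=
  (∀ N, AbsConv (rowPow x A N) A) ∧ TendstoTV (rowPow x A) b

end MarkovPerturbation

namespace MarkovPerturbation

variable {S : Type*}

/-! ### Absolutely convergent products -/

/-! Write `A = (R - P) D`. Right multiplication by `P` shifts the series defining `D`, giving the
Poisson equation `D (I - P) = I - Π` (`IsDeviationMatrix.rowMul_row`). Since `R - P` has zero row
sums it kills `Π`, so `A (I - P) = R - P`. For the partial sums `μₙ` of the series this says `μₙ₊₁
(I - P) = μₙ (R - P)`, and the limit in total variation is `μ R = μ`. Rows of `D` sum to zero, so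
only the term `k = 0` carries mass and `μ` has mass one (`hasSum_one_and_rowMul_eq`). This is (i).

For (ii), a summable invariant vector of an irreducible stochastic matrix has constant sign
(`nonneg_or_nonpos_of_rowMul_eq`), which gives both positivity of `μ` and uniqueness. If `μ A`
converges absolutely, `μ - μ A` is `P`-invariant of mass one, hence equals `π`; iterating `μ A = μ -
π` gives `μ A^N = μ - μ_N → 0`. The weighted proviso implies absolute convergence: a taboo norm
below one is a geometric drift condition, so `v` is integrable under `π_R`. -/

theorem AbsConv.summable_mul {x : S → ℝ} {B : Matrix S S ℝ} (h : AbsConv x B) {c : S → ℝ} {C : ℝ}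
    (hc : ∀ j, |c j| ≤ C) : Summable fun p : S × S => x p.1 * (B p.1 p.2 * c p.2) := by
  refine Summable.of_norm_bounded (h.abs.mul_right C) fun p => ?_
  rw [← mul_assoc, Real.norm_eq_abs, abs_mul]
  exact mul_le_mul_of_nonneg_left (hc _) (abs_nonneg _)

/-- Associativity of `xᵀ B c` for an absolutely convergent product `xᵀ B` and a bounded `c`. -/
theorem AbsConv.tsum_rowMul_mul {x : S → ℝ} {B : Matrix S S ℝ} (h : AbsConv x B) {c : S → ℝ}
    {C : ℝ} (hc : ∀ j, |c j| ≤ C) :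
    ∑' j, rowMul x B j * c j = ∑' i, x i * ∑' j, B i j * c j := by
  have hs := h.summable_mul hc
  have := Summable.tsum_comm (f := fun i j => x i * (B i j * c j)) hs
  simp only [tsum_mul_left] at this
  rw [← this]
  refine tsum_congr fun j => ?_
  rw [rowMul, ← tsum_mul_right]
  simp only [mul_assoc]

theorem AbsConv.summable_mul_tsum {x : S → ℝ} {B : Matrix S S ℝ} (h : AbsConv x B) {c : S → ℝ}
    {C : ℝ} (hc : ∀ j, |c j| ≤ C) : Summable fun i => x i * ∑' j, B i j * c j := by
  simpa only [tsum_mul_left] using (h.summable_mul hc).prod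

theorem AbsConv.summable_col {x : S → ℝ} {B : Matrix S S ℝ} (h : AbsConv x B) (j : S) :
    Summable fun i => x i * B i j :=
  (Summable.prod_symm h).prod_factor j

theorem AbsConv.summable_rowMul {x : S → ℝ} {B : Matrix S S ℝ} (h : AbsConv x B) :
    Summable (rowMul x B) :=
  (Summable.prod_symm h).prod

theorem AbsConv.tsum_rowMul {x : S → ℝ} {B : Matrix S S ℝ} (h : AbsConv x B) :
    ∑' j, rowMul x B j = ∑' i, x i * ∑' j, B i j := by
  simpa using h.tsum_rowMul_mul (c := fun _ => 1) (C := 1) (by simp)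

theorem AbsConv.sub {x y : S → ℝ} {B : Matrix S S ℝ} (hx : AbsConv x B) (hy : AbsConv y B) :
    AbsConv (x - y) B := by
  simpa only [AbsConv, Pi.sub_apply, sub_mul] using Summable.sub hx hy

theorem AbsConv.rowMul_sub {x y : S → ℝ} {B : Matrix S S ℝ} (hx : AbsConv x B)
    (hy : AbsConv y B) : rowMul (x - y) B = rowMul x B - rowMul y B := by
  ext j
  simp only [rowMul, Pi.sub_apply, sub_mul]
  exact (hx.summable_col j).tsum_sub (hy.summable_col j)

theorem AbsConv.add {x y : S → ℝ} {B : Matrix S S ℝ} (hx : AbsConv x B) (hy : AbsConv y B) :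
    AbsConv (x + y) B := by
  simpa only [AbsConv, Pi.add_apply, add_mul] using Summable.add hx hy

theorem AbsConv.rowMul_add {x y : S → ℝ} {B : Matrix S S ℝ} (hx : AbsConv x B)
    (hy : AbsConv y B) : rowMul (x + y) B = rowMul x B + rowMul y B := by
  ext j
  simp only [rowMul, Pi.add_apply, add_mul]
  exact (hx.summable_col j).tsum_add (hy.summable_col j)

theorem absConv_zero (B : Matrix S S ℝ) : AbsConv 0 B := by
  simp [AbsConv]

theorem rowMul_zero (B : Matrix S S ℝ) : rowMul 0 B = 0 := by
  ext j
  simp [rowMul]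

theorem AbsConv.sum {x : ℕ → S → ℝ} {B : Matrix S S ℝ} (hx : ∀ k, AbsConv (x k) B) (n : ℕ) :
    AbsConv (∑ k ∈ Finset.range n, x k) B := by
  induction n with
  | zero => simpa using absConv_zero B
  | succ n ih => rw [Finset.sum_range_succ]; exact ih.add (hx n)

theorem AbsConv.rowMul_sum {x : ℕ → S → ℝ} {B : Matrix S S ℝ} (hx : ∀ k, AbsConv (x k) B)
    (n : ℕ) : rowMul (∑ k ∈ Finset.range n, x k) B = ∑ k ∈ Finset.range n, rowMul (x k) B := by
  induction n with
  | zero => simpa using rowMul_zero B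
  | succ n ih =>
    rw [Finset.sum_range_succ, Finset.sum_range_succ, (AbsConv.sum hx n).rowMul_add (hx n), ih]

/-! ### Stochastic matrices acting on summable row vectors -/

theorem IsStochastic.abs_le_one {Q : Matrix S S ℝ} (hQ : IsStochastic Q) (i j : S) :
    |Q i j| ≤ 1 := by
  rw [abs_of_nonneg (hQ.nonneg i j)]
  exact le_hasSum (hQ.row_sum i) j fun k _ => hQ.nonneg i k

theorem IsStochastic.absConv {Q : Matrix S S ℝ} (hQ : IsStochastic Q) {x : S → ℝ}
    (hx : Summable x) : AbsConv x Q := by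
  rw [AbsConv, ← summable_abs_iff, summable_prod_of_nonneg fun _ => abs_nonneg _]
  simp only [abs_mul, abs_of_nonneg (hQ.nonneg _ _), tsum_mul_left, (hQ.row_sum _).tsum_eq, mul_one]
  exact ⟨fun i => (hQ.row_sum i).summable.mul_left _, hx.abs⟩

theorem IsStochastic.tsum_rowMul {Q : Matrix S S ℝ} (hQ : IsStochastic Q) {x : S → ℝ}
    (hx : Summable x) : ∑' j, rowMul x Q j = ∑' j, x j := by
  simp only [(hQ.absConv hx).tsum_rowMul, (hQ.row_sum _).tsum_eq, mul_one]

theorem IsStationary.rowMul_eq {Q : Matrix S S ℝ} {ρ : S → ℝ} (h : IsStationary Q ρ) :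
    rowMul ρ Q = ρ :=
  funext fun j => (h.invariant j).tsum_eq

theorem isStationary_of_rowMul_eq {Q : Matrix S S ℝ} (hQ : IsStochastic Q) {ρ : S → ℝ}
    (h0 : ∀ i, 0 ≤ ρ i) (h1 : HasSum ρ 1) (h : rowMul ρ Q = ρ) : IsStationary Q ρ :=
  ⟨h0, h1, fun j => by
    simpa only [show ∑' i, ρ i * Q i j = ρ j from congrFun h j] using
      ((hQ.absConv h1.summable).summable_col j).hasSum⟩

/-! ### Invariant row vectors of irreducible stochastic matrices -/

theorem rowMul_pos_of_pos {Q : Matrix S S ℝ} (hQ : IsStochastic Q) {u : S → ℝ} (hu : Summable u)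
    (h0 : ∀ i, 0 ≤ u i) {i j : S} (hi : 0 < u i) (hij : 0 < Q i j) : 0 < rowMul u Q j :=
  ((hQ.absConv hu).summable_col j).tsum_pos (fun k => mul_nonneg (h0 k) (hQ.nonneg k j)) i
    (mul_pos hi hij)

/-- Positivity propagates along each edge of a path from `i` to `j`. -/
theorem pos_of_rowMul_eq {Q : Matrix S S ℝ} (hQ : IsStochastic Q) (hirr : Q.IsIrreducible)
    {u : S → ℝ} (hu : Summable u) (h0 : ∀ i, 0 ≤ u i) (h : rowMul u Q = u) {i : S}
    (hi : 0 < u i) (j : S) : 0 < u j := by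
  let := Q.toQuiver
  obtain ⟨p, -⟩ := hirr.connected i j
  induction p with
  | nil => exact hi
  | cons p e ih => rw [← h]; exact rowMul_pos_of_pos hQ hu h0 ih e.down

/-- The triangle inequality gives `|x| ≤ |x| Q` entrywise; both sides have the same total mass, so
equality holds everywhere. -/
theorem rowMul_abs_eq {Q : Matrix S S ℝ} (hQ : IsStochastic Q) {x : S → ℝ} (hx : Summable x)
    (h : rowMul x Q = x) : rowMul |x| Q = |x| := by
  have hax : Summable |x| := hx.abs
  have hc := hQ.absConv hax
  have hle : ∀ j, |x| j ≤ rowMul |x| Q j := fun j => by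
    have hs := (hQ.absConv hx).summable_col j
    calc |x| j = |rowMul x Q j| := by rw [h]; rfl
      _ ≤ ∑' i, |x i * Q i j| := norm_tsum_le_tsum_norm hs.norm
      _ = rowMul |x| Q j := by simp [rowMul, abs_mul, abs_of_nonneg (hQ.nonneg _ _)]
  have hsum : HasSum (fun j => rowMul |x| Q j - |x| j) 0 := by
    have := hc.summable_rowMul.hasSum.sub hax.hasSum
    rwa [hQ.tsum_rowMul hax, sub_self] at this
  have := (hasSum_zero_iff_of_nonneg fun j => sub_nonneg.2 (hle j)).1 hsum
  ext j
  exact sub_eq_zero.1 (congrFun this j)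

/-- A summable invariant row vector of an irreducible stochastic matrix has constant sign. -/
theorem nonneg_or_nonpos_of_rowMul_eq {Q : Matrix S S ℝ} (hQ : IsStochastic Q)
    (hirr : Q.IsIrreducible) {x : S → ℝ} (hx : Summable x) (h : rowMul x Q = x) :
    (∀ i, 0 ≤ x i) ∨ ∀ i, x i ≤ 0 := by
  by_contra! hcon
  obtain ⟨⟨i, hi⟩, j, hj⟩ := hcon
  have hax : Summable |x| := hx.abs
  -- `|x| + x` is invariant, nonnegative and positive at `j`, hence positive everywhere, yet it
  -- vanishes at `i`, where `x` is negative.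
  have hu : rowMul (|x| + x) Q = |x| + x := by
    rw [(hQ.absConv hax).rowMul_add (hQ.absConv hx), rowMul_abs_eq hQ hx h, h]
  have := pos_of_rowMul_eq hQ hirr (hax.add hx)
    (fun k => by simp only [Pi.abs_apply]; linarith [neg_abs_le (x k)]) hu
    (i := j) (add_pos (abs_pos.2 hj.ne') hj) i
  simp [abs_of_neg hi] at this

theorem eq_zero_of_rowMul_eq {Q : Matrix S S ℝ} (hQ : IsStochastic Q) (hirr : Q.IsIrreducible)
    {x : S → ℝ} (hx : HasSum x 0) (h : rowMul x Q = x) : x = 0 := by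
  rcases nonneg_or_nonpos_of_rowMul_eq hQ hirr hx.summable h with h0 | h0
  · exact (hasSum_zero_iff_of_nonneg h0).1 hx
  · have hneg : HasSum (-x) (-0) := hx.neg
    rw [neg_zero] at hneg
    exact neg_eq_zero.1 <| (hasSum_zero_iff_of_nonneg fun i => neg_nonneg.2 (h0 i)).1 hneg

theorem eq_of_rowMul_eq {Q : Matrix S S ℝ} (hQ : IsStochastic Q) (hirr : Q.IsIrreducible)
    {x y : S → ℝ} {a : ℝ} (hx : HasSum x a) (hy : HasSum y a) (hxQ : rowMul x Q = x)
    (hyQ : rowMul y Q = y) : x = y := by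
  have hxy : HasSum (x - y) (a - a) := hx.sub hy
  rw [sub_self] at hxy
  refine sub_eq_zero.1 (eq_zero_of_rowMul_eq hQ hirr hxy ?_)
  rw [(hQ.absConv hx.summable).rowMul_sub (hQ.absConv hy.summable), hxQ, hyQ]

/-! ### Convergence in total variation -/

theorem summable_of_tsum_ofReal_ne_top {f : S → ℝ} (h0 : ∀ i, 0 ≤ f i)
    (h : ∑' i, ENNReal.ofReal (f i) ≠ ⊤) : Summable f := by
  simpa only [ENNReal.toReal_ofReal (h0 _)] using ENNReal.summable_toReal h

theorem TendstoTV.summable {x : ℕ → S → ℝ} {y : S → ℝ} (h : TendstoTV x y)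
    (hx : ∀ n, Summable (x n)) : Summable y := by
  -- The distance may be infinite for some `n`, but it tends to zero, so one finite value can be
  -- chosen.
  obtain ⟨n, hn⟩ := (h.eventually (gt_mem_nhds ENNReal.zero_lt_top)).exists
  have := (summable_of_tsum_ofReal_ne_top (fun _ => abs_nonneg _) hn.ne).of_abs
  simpa using (hx n).sub this

theorem summable_abs_mul {z c : S → ℝ} (hz : Summable z) {C : ℝ} (hc : ∀ j, |c j| ≤ C) :
    Summable fun j => |z j * c j| := by
  refine Summable.of_nonneg_of_le (fun _ => abs_nonneg _) (fun j => ?_) (hz.abs.mul_right C)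
  rw [abs_mul]
  exact mul_le_mul_of_nonneg_left (hc j) (abs_nonneg _)

theorem abs_tsum_mul_le {z c : S → ℝ} (hz : Summable z) {C : ℝ} (hc : ∀ j, |c j| ≤ C) :
    |∑' j, z j * c j| ≤ (∑' j, ENNReal.ofReal |z j|).toReal * C := by
  have hzc := summable_abs_mul hz hc
  have hle : ∀ j, |z j * c j| ≤ |z j| * C := fun j => by
    rw [abs_mul]
    exact mul_le_mul_of_nonneg_left (hc j) (abs_nonneg _)
  have h1 : |∑' j, z j * c j| ≤ ∑' j, |z j * c j| :=
    norm_tsum_le_tsum_norm (f := fun j => z j * c j) hzc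
  have h2 : ∑' j, |z j * c j| ≤ ∑' j, |z j| * C :=
    Summable.tsum_le_tsum hle hzc (hz.abs.mul_right C)
  have h3 : (∑' j, ENNReal.ofReal |z j|).toReal = ∑' j, |z j| := by
    rw [ENNReal.tsum_toReal_eq fun _ => ENNReal.ofReal_ne_top]
    exact tsum_congr fun j => ENNReal.toReal_ofReal (abs_nonneg _)
  rw [h3, ← tsum_mul_right]
  exact h1.trans h2

/-- The single source of limits below: taking `c` constant, a point mass or a column of a stochastic
matrix gives convergence of masses, entries and products. -/
theorem TendstoTV.tendsto_tsum_mul {x : ℕ → S → ℝ} {y : S → ℝ} (h : TendstoTV x y)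
    (hx : ∀ n, Summable (x n)) {c : S → ℝ} {C : ℝ} (hc : ∀ j, |c j| ≤ C) :
    Tendsto (fun n => ∑' j, x n j * c j) atTop (𝓝 (∑' j, y j * c j)) := by
  have hy := h.summable hx
  have hlim : Tendsto (fun n => (∑' j, ENNReal.ofReal |x n j - y j|).toReal * C) atTop (𝓝 0) := by
    have := ((ENNReal.tendsto_toReal ENNReal.zero_ne_top).comp h).mul_const C
    rwa [ENNReal.toReal_zero, zero_mul] at this
  rw [tendsto_iff_dist_tendsto_zero]
  refine squeeze_zero (fun _ => dist_nonneg) (fun n => ?_) hlim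
  rw [Real.dist_eq, ← (summable_abs_mul (hx n) hc).of_abs.tsum_sub (summable_abs_mul hy hc).of_abs]
  simp only [← sub_mul]
  exact abs_tsum_mul_le ((hx n).sub hy) hc

theorem TendstoTV.tendsto_tsum {x : ℕ → S → ℝ} {y : S → ℝ} (h : TendstoTV x y)
    (hx : ∀ n, Summable (x n)) : Tendsto (fun n => ∑' j, x n j) atTop (𝓝 (∑' j, y j)) := by
  simpa using h.tendsto_tsum_mul hx (c := fun _ => 1) (C := 1) (by simp)

theorem TendstoTV.tendsto_rowMul {x : ℕ → S → ℝ} {y : S → ℝ} (h : TendstoTV x y)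
    (hx : ∀ n, Summable (x n)) {Q : Matrix S S ℝ} (hQ : IsStochastic Q) (j : S) :
    Tendsto (fun n => rowMul (x n) Q j) atTop (𝓝 (rowMul y Q j)) :=
  h.tendsto_tsum_mul hx fun i => hQ.abs_le_one i j

theorem TendstoTV.tendsto_apply {x : ℕ → S → ℝ} {y : S → ℝ} (h : TendstoTV x y)
    (hx : ∀ n, Summable (x n)) (j : S) : Tendsto (fun n => x n j) atTop (𝓝 (y j)) := by
  classical
  simpa using h.tendsto_tsum_mul hx (c := fun i => if i = j then 1 else 0) (C := 1)
    (fun i => by split_ifs <;> simp)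

/-! ### The deviation matrix -/

theorem hasSum_matPow {P : Matrix S S ℝ} (hP : IsStochastic P) (k : ℕ) (i : S) :
    HasSum (matPow P k i) 1 := by
  induction k with
  | zero =>
    classical
    simp only [matPow]
    convert hasSum_ite_eq i (1 : ℝ) using 3
    exact eq_comm
  | succ k ih =>
    have := (hP.absConv ih.summable).summable_rowMul.hasSum
    rwa [hP.tsum_rowMul ih.summable, ih.tsum_eq] at this

theorem hasSum_sum_matPow_sub {P : Matrix S S ℝ} (hP : IsStochastic P) {ρ : S → ℝ}
    (hρ : IsStationary P ρ) (i : S) (n : ℕ) :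
    HasSum (∑ k ∈ Finset.range n, (matPow P k i - ρ)) 0 := by
  have : HasSum (fun j => ∑ k ∈ Finset.range n, (matPow P k i - ρ) j)
      (∑ k ∈ Finset.range n, ((1 : ℝ) - 1)) :=
    hasSum_sum fun k _ => (hasSum_matPow hP k i).sub hρ.sum_one
  simp only [sub_self, Finset.sum_const_zero] at this
  convert this using 1
  ext j
  simp

theorem IsDeviationMatrix.tendstoTV {P D : Matrix S S ℝ} {ρ : S → ℝ}
    (hD : IsDeviationMatrix P ρ D) (i : S) :
    TendstoTV (fun n => ∑ k ∈ Finset.range n, (matPow P k i - ρ)) (D i) := by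
  convert hD i using 2 with n
  ext j
  simp

theorem IsDeviationMatrix.hasSum_row {P D : Matrix S S ℝ} (hP : IsStochastic P) {ρ : S → ℝ}
    (hρ : IsStationary P ρ) (hD : IsDeviationMatrix P ρ D) (i : S) : HasSum (D i) 0 := by
  have hs := fun n => hasSum_sum_matPow_sub hP hρ i n
  have hsum := (hD.tendstoTV i).summable fun n => (hs n).summable
  have hlim := (hD.tendstoTV i).tendsto_tsum fun n => (hs n).summable
  simp only [(hs _).tsum_eq] at hlim
  rw [← tendsto_nhds_unique hlim tendsto_const_nhds]
  exact hsum.hasSum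

/-- The Poisson equation `D (I - P) = I - Π`. -/
theorem IsDeviationMatrix.rowMul_row {P D : Matrix S S ℝ} (hP : IsStochastic P) {ρ : S → ℝ}
    (hρ : IsStationary P ρ) (hD : IsDeviationMatrix P ρ D) (i : S) :
    rowMul (D i) P = D i - (matPow P 0 i - ρ) := by
  have hs := fun n => (hasSum_sum_matPow_sub hP hρ i n).summable
  have hc := fun k => hP.absConv (hasSum_matPow hP k i).summable
  have hcρ := hP.absConv hρ.sum_one.summable
  -- As `ρ P = ρ`, multiplying by `P` raises every power by one, so only the term `k = 0` is lost.
  have step : ∀ n, rowMul (∑ k ∈ Finset.range n, (matPow P k i - ρ)) P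
      = ∑ k ∈ Finset.range (n + 1), (matPow P k i - ρ) - (matPow P 0 i - ρ) := fun n => by
    rw [AbsConv.rowMul_sum fun k => (hc k).sub hcρ, Finset.sum_range_succ', add_sub_cancel_right]
    refine Finset.sum_congr rfl fun k _ => ?_
    rw [(hc k).rowMul_sub hcρ, hρ.rowMul_eq]
    rfl
  ext j
  have h1 := (hD.tendstoTV i).tendsto_rowMul hs hP j
  have h2 := (((hD.tendstoTV i).tendsto_apply hs j).comp (tendsto_add_atTop_nat 1)).sub_const
    ((matPow P 0 i - ρ) j)
  refine tendsto_nhds_unique h1 (h2.congr fun n => ?_)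
  rw [step n]
  rfl

/-! ### The perturbation matrix `(R - P) D` -/

section Perturbation

variable {P R D : Matrix S S ℝ} {ρ : S → ℝ}

theorem hasSum_row_sub (hP : IsStochastic P) (hR : IsStochastic R) (i : S) :
    HasSum ((R - P) i) 0 := by
  have : HasSum ((R - P) i) (1 - 1) := (hR.row_sum i).sub (hP.row_sum i)
  rwa [sub_self] at this

theorem tsum_mulMat_row (hP : IsStochastic P) (hρ : IsStationary P ρ)
    (hD : IsDeviationMatrix P ρ D) (hRD : ∀ i, AbsConv ((R - P) i) D) (i : S) :
    ∑' j, mulMat (R - P) D i j = 0 := by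
  refine (hRD i).tsum_rowMul.trans ?_
  simp only [(hD.hasSum_row hP hρ _).tsum_eq, mul_zero, tsum_zero]

theorem rowMul_mulMat_row (hP : IsStochastic P) (hR : IsStochastic R) (hρ : IsStationary P ρ)
    (hD : IsDeviationMatrix P ρ D) (hRD : ∀ i, AbsConv ((R - P) i) D) (i : S) :
    rowMul (mulMat (R - P) D i) P = mulMat (R - P) D i - (R - P) i := by
  classical
  have h0 := hasSum_row_sub hP hR i
  ext j
  have h1 : ∀ l, ∑' k, D l k * P k j = D l j - ((if l = j then 1 else 0) - ρ j) := fun l => by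
    refine (congrFun (hD.rowMul_row hP hρ l) j).trans ?_
    simp only [Pi.sub_apply, matPow]
  -- The `ρ j` part disappears because row `i` of `R - P` sums to zero.
  have h2 : HasSum (fun l => (R - P) i l * ((if l = j then 1 else 0) - ρ j)) ((R - P) i j) := by
    have := (hasSum_ite_eq j ((R - P) i j)).sub (h0.mul_right (ρ j))
    rw [zero_mul, sub_zero] at this
    refine this.congr_fun fun l => ?_
    by_cases hl : l = j
    · subst hl; simp [mul_sub]
    · simp [hl]
  have h3 := (hRD i).tsum_rowMul_mul fun k => hP.abs_le_one k j
  have h4 := ((hRD i).summable_col j).hasSum.sub h2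
  simp only [← mul_sub, ← h1] at h4
  exact h3.trans h4.tsum_eq

/-- For summable `x`, `xᵀ (R - P) D (I - P) = xᵀ (R - P)`. -/
theorem rowMul_rowMul_mulMat (hP : IsStochastic P) (hR : IsStochastic R) (hρ : IsStationary P ρ)
    (hD : IsDeviationMatrix P ρ D) (hRD : ∀ i, AbsConv ((R - P) i) D) {x : S → ℝ}
    (hx : Summable x) (hxA : AbsConv x (mulMat (R - P) D)) :
    rowMul (rowMul x (mulMat (R - P) D)) P
      = rowMul x (mulMat (R - P) D) - rowMul x R + rowMul x P := by
  ext j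
  have h1 : ∀ i, ∑' k, mulMat (R - P) D i k * P k j = mulMat (R - P) D i j - (R i j - P i j) :=
    fun i => congrFun (rowMul_mulMat_row hP hR hρ hD hRD i) j
  have h2 := hxA.tsum_rowMul_mul fun k => hP.abs_le_one k j
  have h3 := ((hxA.summable_col j).hasSum.sub ((hR.absConv hx).summable_col j).hasSum).add
    ((hP.absConv hx).summable_col j).hasSum
  simp only [h1] at h2
  refine h2.trans (Eq.trans (tsum_congr fun i => ?_) h3.tsum_eq)
  ring

theorem AbsConv.hasSum_rowMul_mulMat (hP : IsStochastic P) (hρ : IsStationary P ρ)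
    (hD : IsDeviationMatrix P ρ D) (hRD : ∀ i, AbsConv ((R - P) i) D) {x : S → ℝ}
    (hxA : AbsConv x (mulMat (R - P) D)) : HasSum (rowMul x (mulMat (R - P) D)) 0 := by
  have := hxA.summable_rowMul.hasSum
  rwa [hxA.tsum_rowMul, tsum_congr fun i => by rw [tsum_mulMat_row hP hρ hD hRD i, mul_zero],
    tsum_zero] at this

theorem summable_rowPow {x : S → ℝ} {A : Matrix S S ℝ} (hx : Summable x)
    (h : ∀ k, AbsConv (rowPow x A k) A) : ∀ k, Summable (rowPow x A k)
  | 0 => hx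
  | k + 1 => (h k).summable_rowMul

theorem hasSum_sum_rowPow (hP : IsStochastic P) (hρ : IsStationary P ρ)
    (hD : IsDeviationMatrix P ρ D) (hRD : ∀ i, AbsConv ((R - P) i) D)
    (hterm : ∀ k, AbsConv (rowPow ρ (mulMat (R - P) D) k) (mulMat (R - P) D)) (n : ℕ) :
    HasSum (∑ k ∈ Finset.range (n + 1), rowPow ρ (mulMat (R - P) D) k) 1 := by
  induction n with
  | zero => rw [zero_add, Finset.sum_range_one]; exact hρ.sum_one
  | succ n ih =>
    rw [Finset.sum_range_succ, ← add_zero (1 : ℝ)]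
    exact ih.add ((hterm n).hasSum_rowMul_mulMat hP hρ hD hRD)

/-- Sums `rowMul_rowMul_mulMat` over `k`; the extra leading term is fixed by `P`. -/
theorem rowMul_sum_rowPow (hP : IsStochastic P) (hR : IsStochastic R) (hρ : IsStationary P ρ)
    (hD : IsDeviationMatrix P ρ D) (hRD : ∀ i, AbsConv ((R - P) i) D)
    (hterm : ∀ k, AbsConv (rowPow ρ (mulMat (R - P) D) k) (mulMat (R - P) D)) (n : ℕ) :
    rowMul (∑ k ∈ Finset.range (n + 1), rowPow ρ (mulMat (R - P) D) k) P
      = ∑ k ∈ Finset.range (n + 1), rowPow ρ (mulMat (R - P) D) k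
        - rowMul (∑ k ∈ Finset.range n, rowPow ρ (mulMat (R - P) D) k) R
        + rowMul (∑ k ∈ Finset.range n, rowPow ρ (mulMat (R - P) D) k) P := by
  have hs := summable_rowPow hρ.sum_one.summable hterm
  rw [AbsConv.rowMul_sum fun k => hP.absConv (hs k), AbsConv.rowMul_sum fun k => hR.absConv (hs k),
    AbsConv.rowMul_sum fun k => hP.absConv (hs k), Finset.sum_range_succ', Finset.sum_range_succ']
  have : ∀ k, rowMul (rowPow ρ (mulMat (R - P) D) (k + 1)) P
      = rowPow ρ (mulMat (R - P) D) (k + 1) - rowMul (rowPow ρ (mulMat (R - P) D) k) R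
        + rowMul (rowPow ρ (mulMat (R - P) D) k) P :=
    fun k => rowMul_rowMul_mulMat hP hR hρ hD hRD (hs k) (hterm k)
  simp only [this, Finset.sum_add_distrib, Finset.sum_sub_distrib]
  rw [show rowMul (rowPow ρ (mulMat (R - P) D) 0) P = rowPow ρ (mulMat (R - P) D) 0 from
    hρ.rowMul_eq]
  abel

/-- The sum of the perturbation series is an invariant row vector of `R` with total mass one. -/
theorem hasSum_one_and_rowMul_eq (hP : IsStochastic P) (hR : IsStochastic R)
    (hρ : IsStationary P ρ) (hD : IsDeviationMatrix P ρ D) (hRD : ∀ i, AbsConv ((R - P) i) D)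
    (hterm : ∀ k, AbsConv (rowPow ρ (mulMat (R - P) D) k) (mulMat (R - P) D)) {μ : S → ℝ}
    (hμ : TendstoTV (fun n => ∑ k ∈ Finset.range n, rowPow ρ (mulMat (R - P) D) k) μ) :
    HasSum μ 1 ∧ rowMul μ R = μ := by
  have h1 := hasSum_sum_rowPow hP hρ hD hRD hterm
  have hs : ∀ n, Summable (∑ k ∈ Finset.range n, rowPow ρ (mulMat (R - P) D) k)
    | 0 => summable_zero
    | n + 1 => (h1 n).summable
  constructor
  · have hlim := (hμ.tendsto_tsum hs).comp (tendsto_add_atTop_nat 1)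
    have : ∑' j, μ j = 1 :=
      tendsto_nhds_unique hlim (tendsto_const_nhds.congr fun n => (h1 n).tsum_eq.symm)
    rw [← this]
    exact (hμ.summable hs).hasSum
  · ext j
    have hl := (hμ.tendsto_rowMul hs hP j).comp (tendsto_add_atTop_nat 1)
    have hr := (((hμ.tendsto_apply hs j).comp (tendsto_add_atTop_nat 1)).sub
      (hμ.tendsto_rowMul hs hR j)).add (hμ.tendsto_rowMul hs hP j)
    have := tendsto_nhds_unique hl <| hr.congr fun n =>
      (congrFun (rowMul_sum_rowPow hP hR hρ hD hRD hterm n) j).symm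
    linarith

/-- The bias term vanishes as soon as its first product converges absolutely. -/
theorem hasBiasTerm_zero (hP : IsStochastic P) (hR : IsStochastic R) (hPirr : P.IsIrreducible)
    (hρ : IsStationary P ρ) (hD : IsDeviationMatrix P ρ D) (hRD : ∀ i, AbsConv ((R - P) i) D)
    (hterm : ∀ k, AbsConv (rowPow ρ (mulMat (R - P) D) k) (mulMat (R - P) D)) {μ : S → ℝ}
    (hμ : TendstoTV (fun n => ∑ k ∈ Finset.range n, rowPow ρ (mulMat (R - P) D) k) μ)
    (hμA : AbsConv μ (mulMat (R - P) D)) : HasBiasTerm μ (mulMat (R - P) D) 0 := by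
  obtain ⟨h1, hinv⟩ := hasSum_one_and_rowMul_eq hP hR hρ hD hRD hterm hμ
  have hAsum := hμA.hasSum_rowMul_mulMat hP hρ hD hRD
  have hfirst : rowMul μ (mulMat (R - P) D) = μ - ρ := by
    have hsub : HasSum (μ - rowMul μ (mulMat (R - P) D)) 1 := by
      rw [← sub_zero (1 : ℝ)]
      exact h1.sub hAsum
    -- Invariance under `P`: `(μ - μ A) P = μ P - (μ A - μ R + μ P) = μ - μ A`, using `μ R = μ`.
    have := eq_of_rowMul_eq hP hPirr hsub hρ.sum_one (by
      rw [(hP.absConv h1.summable).rowMul_sub (hP.absConv hAsum.summable),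
        rowMul_rowMul_mulMat hP hR hρ hD hRD h1.summable hμA, hinv]
      abel) hρ.rowMul_eq
    rw [← this]
    abel
  have hpow : ∀ N, rowPow μ (mulMat (R - P) D) N
      = μ - ∑ k ∈ Finset.range N, rowPow ρ (mulMat (R - P) D) k := fun N => by
    induction N with
    | zero => simp [rowPow]
    | succ N ih =>
      rw [rowPow, ih, hμA.rowMul_sub (AbsConv.sum hterm N), AbsConv.rowMul_sum hterm, hfirst,
        Finset.sum_range_succ', sub_sub, add_comm ρ]
      rfl
  refine ⟨fun N => ?_, ?_⟩
  · rw [hpow]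
    exact hμA.sub (AbsConv.sum hterm N)
  · have h := hμ
    unfold TendstoTV at h ⊢
    convert h using 5 with n j
    rw [hpow, Pi.zero_apply, sub_zero, Pi.sub_apply, abs_sub_comm]

end Perturbation

/-! ### Weighted norms -/

theorem summable_and_tsum_le_of_vNorm_lt_top {v : S → ℝ} (hv : IsWeight v) {B : Matrix S S ℝ}
    (hB : vNorm v B < ⊤) (i : S) :
    (Summable fun j => |B i j| * v j) ∧ ∑' j, |B i j| * v j ≤ (vNorm v B).toReal * v i := by
  have hv0 : ∀ j, 0 < v j := fun j => zero_lt_one.trans_le (hv j)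
  have h0 : ∀ j, 0 ≤ |B i j| * v j := fun j => mul_nonneg (abs_nonneg _) (hv0 j).le
  have hle : ∑' j, ENNReal.ofReal (|B i j| * v j) ≤ vNorm v B * ENNReal.ofReal (v i) := by
    rw [← ENNReal.div_le_iff (by simpa using hv0 i) ENNReal.ofReal_ne_top]
    exact le_iSup (fun i => (∑' j, ENNReal.ofReal (|B i j| * v j)) / ENNReal.ofReal (v i)) i
  have htop : vNorm v B * ENNReal.ofReal (v i) ≠ ⊤ := ENNReal.mul_ne_top hB.ne ENNReal.ofReal_ne_top
  have hs := summable_of_tsum_ofReal_ne_top h0 (ne_top_of_le_ne_top htop hle)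
  refine ⟨hs, ?_⟩
  have := ENNReal.toReal_mono htop hle
  rwa [← ENNReal.ofReal_tsum_of_nonneg h0 hs, ENNReal.toReal_ofReal (tsum_nonneg h0),
    ENNReal.toReal_mul, ENNReal.toReal_ofReal (hv0 i).le] at this

/-- Geometric drift: `R v ≤ r v + b`. -/
theorem summable_and_tsum_le_of_vNorm_taboo_lt_top {R : Matrix S S ℝ} (hR : IsStochastic R)
    {v : S → ℝ} (hv : IsWeight v) {i : S} (hi : vNorm v (taboo R i) < ⊤) (k : S) :
    (Summable fun j => R k j * v j) ∧
      ∑' j, R k j * v j ≤ (vNorm v (taboo R i)).toReal * v k + v i := by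
  classical
  obtain ⟨hs, hle⟩ := summable_and_tsum_le_of_vNorm_lt_top hv hi k
  have h := hs.hasSum.add (hasSum_ite_eq i (R k i * v i))
  have heq : (fun j => |taboo R i k j| * v j + if j = i then R k i * v i else 0)
      = fun j => R k j * v j := by
    ext j
    by_cases hj : j = i
    · subst hj; simp [taboo]
    · simp [taboo, hj, abs_of_nonneg (hR.nonneg k j)]
  rw [heq] at h
  refine ⟨h.summable, h.tsum_eq.le.trans (add_le_add hle ?_)⟩
  -- Restoring column `i` costs `R k i * v i ≤ v i`.
  exact mul_le_of_le_one_left (zero_le_one.trans (hv i))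
    ((le_abs_self _).trans (hR.abs_le_one k i))

/-- A stationary distribution integrates every function satisfying a geometric drift condition. -/
theorem IsStationary.summable_mul_of_drift {R : Matrix S S ℝ} (hR : IsStochastic R) {ρ : S → ℝ}
    (hρ : IsStationary R ρ) {v : S → ℝ} (hv : ∀ i, 0 ≤ v i) {r b : ℝ} (hr : r < 1)
    (hb : 0 ≤ b) (hs : ∀ k, Summable fun j => R k j * v j)
    (hle : ∀ k, ∑' j, R k j * v j ≤ r * v k + b) : Summable fun k => ρ k * v k := by
  refine summable_of_sum_le (c := b / (1 - r)) (fun k => mul_nonneg (hρ.nonneg k) (hv k))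
    fun F => ?_
  rw [le_div_iff₀ (by linarith)]
  -- Integrability of `v` is not yet known, so invariance is applied to the bounded truncation `min
  -- v M`; this `M` leaves `v` unchanged on `F`.
  set M : ℝ := ∑ k ∈ F, v k with hM
  have hM0 : 0 ≤ M := Finset.sum_nonneg fun k _ => hv k
  have hFM : ∀ k ∈ F, v k ≤ M := fun k hk => Finset.single_le_sum (fun k _ => hv k) hk
  have hf0 : ∀ j, 0 ≤ min (v j) M := fun j => le_min (hv j) hM0
  have hf : ∀ j, |min (v j) M| ≤ M := fun j => by rw [abs_of_nonneg (hf0 j)]; exact min_le_right _ _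
  have hc := hR.absConv hρ.sum_one.summable
  have hsf : ∀ k, Summable fun j => R k j * min (v j) M := fun k =>
    Summable.of_nonneg_of_le (fun j => mul_nonneg (hR.nonneg k j) (hf0 j))
      (fun j => mul_le_mul_of_nonneg_left (min_le_left _ _) (hR.nonneg k j)) (hs k)
  have h1 : ∀ k, ∑' j, R k j * min (v j) M ≤ r * v k + b := fun k =>
    ((hsf k).tsum_le_tsum
      (fun j => mul_le_mul_of_nonneg_left (min_le_left _ _) (hR.nonneg k j)) (hs k)).trans (hle k)
  have h2 : ∀ k, ∑' j, R k j * min (v j) M ≤ M := fun k => by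
    have := (hsf k).tsum_le_tsum
      (fun j => mul_le_mul_of_nonneg_left (min_le_right _ _) (hR.nonneg k j))
      ((hR.row_sum k).summable.mul_right M)
    rwa [tsum_mul_right, (hR.row_sum k).tsum_eq, one_mul] at this
  have hfs : Summable fun j => ρ j * min (v j) M :=
    Summable.of_nonneg_of_le (fun j => mul_nonneg (hρ.nonneg j) (hf0 j))
      (fun j => mul_le_mul_of_nonneg_left (min_le_right _ _) (hρ.nonneg j))
      (hρ.sum_one.summable.mul_right M)
  have hinv := hc.tsum_rowMul_mul hf
  rw [hρ.rowMul_eq] at hinv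
  have hsum := (hfs.hasSum.sub (hc.summable_mul_tsum hf).hasSum).add (hρ.sum_one.mul_right b)
  rw [hinv, sub_self, zero_add, one_mul] at hsum
  -- With `f = min v M`, the terms `ρ (f - R f + b)` are nonnegative with total `b`, and on `F` each
  -- is at least `(1 - r) ρ v`.
  calc (∑ k ∈ F, ρ k * v k) * (1 - r)
      ≤ ∑ k ∈ F, (ρ k * min (v k) M - ρ k * ∑' j, R k j * min (v j) M + ρ k * b) := by
        rw [Finset.sum_mul]
        refine Finset.sum_le_sum fun k hk => ?_
        rw [min_eq_left (hFM k hk)]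
        nlinarith [mul_le_mul_of_nonneg_left (h1 k) (hρ.nonneg k)]
    _ ≤ b := by
        refine sum_le_hasSum F (fun k _ => ?_) hsum
        rw [← mul_sub, ← mul_add]
        refine mul_nonneg (hρ.nonneg k) ?_
        rcases min_choice (v k) M with h | h <;> rw [h]
        · nlinarith [h1 k, hv k]
        · linarith [h2 k]

/-- Since `v ≥ 1`, the absolute row sums of `B` are at most a multiple of `v`, which `x` integrates.
-/
theorem absConv_of_vNorm_lt_top {v : S → ℝ} (hv : IsWeight v) {x : S → ℝ} (hx0 : ∀ i, 0 ≤ x i)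
    (hx : Summable fun i => x i * v i) {B : Matrix S S ℝ} (hB : vNorm v B < ⊤) : AbsConv x B := by
  have hB' := summable_and_tsum_le_of_vNorm_lt_top hv hB
  have hle : ∀ i j, |B i j| ≤ |B i j| * v j := fun i j =>
    le_mul_of_one_le_right (abs_nonneg _) (hv j)
  have hs : ∀ i, Summable fun j => |B i j| := fun i =>
    Summable.of_nonneg_of_le (fun j => abs_nonneg _) (hle i) (hB' i).1
  rw [AbsConv, ← summable_abs_iff, summable_prod_of_nonneg fun _ => abs_nonneg _]
  simp only [abs_mul, abs_of_nonneg (hx0 _), tsum_mul_left]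
  refine ⟨fun i => (hs i).mul_left _, Summable.of_nonneg_of_le
    (fun i => mul_nonneg (hx0 i) (tsum_nonneg fun j => abs_nonneg _)) (fun i => ?_)
    (hx.mul_right (vNorm v B).toReal)⟩
  calc x i * ∑' j, |B i j| ≤ x i * ((vNorm v B).toReal * v i) :=
        mul_le_mul_of_nonneg_left (((hs i).tsum_le_tsum (hle i) (hB' i).1).trans (hB' i).2) (hx0 i)
    _ = x i * v i * (vNorm v B).toReal := by ring

end MarkovPerturbation

open MarkovPerturbation in
theorem mainTheorem1 {S : Type*} [Countable S] (P R : Matrix S S ℝ)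
    (hP : IsStochastic P) (hR : IsStochastic R)
    (hPirr : P.IsIrreducible) (hPaper : IsAperiodic P) (hPpos : IsPositiveRecurrent P)
    (π : S → ℝ) (hπ : IsStationary P π)
    (D : Matrix S S ℝ) (hD : IsDeviationMatrix P π D)
    (hRD : ∀ i, AbsConv ((R - P) i) D)
    (hterm : ∀ k, AbsConv (rowPow π (mulMat (R - P) D) k) (mulMat (R - P) D))
    (μ : S → ℝ)
    (hμ : TendstoTV
      (fun n j => ∑ k ∈ Finset.range n, rowPow π (mulMat (R - P) D) k j) μ) :
    ((∀ i, 0 ≤ μ i) → IsStationary R μ) ∧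
    (R.IsIrreducible → IsAperiodic R → HasProperTaboo R →
      (IsStationary R μ ∧ ∀ ρ, IsStationary R ρ → ρ = μ) ∧
      ∀ πR, IsStationary R πR →
        (AbsConv πR (mulMat (R - P) D) ∨
          ∃ v, IsWeight v ∧ (∃ i, vNorm v (taboo R i) < 1) ∧
            vNorm v (mulMat (R - P) D) < ⊤) →
        HasBiasTerm πR (mulMat (R - P) D) 0) := by
  have hμ' : TendstoTV (fun n => ∑ k ∈ Finset.range n, rowPow π (mulMat (R - P) D) k) μ := by
    convert hμ using 2 with n
    ext j
    simp
  obtain ⟨h1, hinv⟩ := hasSum_one_and_rowMul_eq hP hR hπ hD hRD hterm hμ'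
  refine ⟨fun h0 => isStationary_of_rowMul_eq hR h0 h1 hinv, fun hRirr _ _ => ?_⟩
  have hμ0 : ∀ i, 0 ≤ μ i := by
    rcases nonneg_or_nonpos_of_rowMul_eq hR hRirr h1.summable hinv with h | h
    · exact h
    · exact absurd (hasSum_le h h1 hasSum_zero) (by norm_num)
  have huniq : ∀ ρ, IsStationary R ρ → ρ = μ := fun ρ hρ =>
    eq_of_rowMul_eq hR hRirr hρ.sum_one h1 hρ.rowMul_eq hinv
  have hstat := isStationary_of_rowMul_eq hR hμ0 h1 hinv
  refine ⟨⟨hstat, huniq⟩, fun πR hπR hA => ?_⟩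
  obtain rfl := huniq πR hπR
  refine hasBiasTerm_zero hP hR hPirr hπ hD hRD hterm hμ' ?_
  rcases hA with hA | ⟨v, hv, ⟨i, hi⟩, hA⟩
  · exact hA
  · have hv0 : ∀ k, 0 ≤ v k := fun k => zero_le_one.trans (hv k)
    have hdrift := summable_and_tsum_le_of_vNorm_taboo_lt_top hR hv (hi.trans ENNReal.one_lt_top)
    refine absConv_of_vNorm_lt_top hv hμ0 ?_ hA
    exact hπR.summable_mul_of_drift hR hv0 (ENNReal.toReal_lt_of_lt_ofReal (by simpa using hi))
      (hv0 i) (fun k => (hdrift k).1) fun k => (hdrift k).2
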